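/- Let $M$ be a smooth $n$-dimensional manifold (Hausdorff, second countable, without boundary) with a Riemannian metric $g$. Let $\mathfrak U=\{U_\alpha\}_{\alpha\in A}$ be a good open cover of $M$ (every nonempty finite intersection $U_{\alpha_0\ldots\alpha_k}=U_{\alpha_0}\cap\dots\cap U_{\alpha_k}$ is contractible) that trivializes the bundle $\mathrm{oFr}(M)$ of orthonormal frames; let a smooth local trivialization over each $U_\alpha$ be given, i.e. a smooth orthonormal frame $e_\alpha$, regarded as isometries $e_\alpha(x)\colon\mathbb R^n\to (T_xM,g_x)$ for $x\in U_\alpha$, with transition functions $g_{\alpha\beta}=e_\beta^{-1}e_\alpha\colon U_\alpha\cap U_\beta\to O(n)$. The function $\det g_{\alpha\beta}$ is constant on $U_\alpha\cap U_\beta$, and $c_{\alpha\beta}:=\det g_{\alpha\beta}\in\mathbb Z_2=\{\pm1\}$ (for $U_\alpha\cap U_\beta\neq\varnothing$) is a Čech 1-cocycle. Its class $$w_1(M):=[c]\in H^1(M,\mathbb Z_2)=\check H^1(\mathfrak U,\mathbb Z_2)=Z^1(\mathfrak U,\mathbb Z_2)/B^1(\mathfrak U,\mathbb Z_2)$$ is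 called the first Stiefel–Whitney class of $M$. Here $\check C^k(\mathfrak U,\mathbb Z_2)$ is the group of all $\mathbb Z_2$-valued functions of the tuples $(\alpha_0,\dots,\alpha_k)$ with $U_{\alpha_0\ldots\alpha_k}\ne\varnothing$, $\delta$ is the usual Čech coboundary operator, and $Z^1$, $B^1$ are the kernel and the image of $\delta$ in $\check C^1$. Theorem. The class $w_1(M)$ does not depend on the choices: the classes obtained from any two good trivializing covers with local trivializations, for any two Riemannian metrics on $M$, become equal on a common refinement of the two covers. Moreover $w_1(M)=0$ if and only if $M$ is orientable, i.e. if and only if one can choose an orientation of every tangent space $T_xM$ so that every point of $M$ has an open neighbourhood carrying a continuous frame of $TM$ that is positively oriented at each of its points. -/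

import Mathlib

open scoped Manifold ContDiff
open TopologicalSpace Bundle

noncomputable section

/-! ## Čech cohomology of an open cover -/

namespace Cech

variable {M : Type*} [TopologicalSpace M] {A : Type*}

/-- A family of open sets covers `M`. -/
def IsCover (U : A → Opens M) : Prop := ∀ x : M, ∃ α, x ∈ U α

/-- The finite intersection `U_{α₀} ∩ ⋯ ∩ U_{αₖ}`. -/
def inter (U : A → Opens M) {k : ℕ} (a : Fin (k + 1) → A) : Set M :=
  ⋂ i, (U (a i) : Set M)

/-- A good cover: an open cover all of whose nonempty finite intersections are contractible. -/
structure IsGoodCover (U : A → Opens M) : Prop where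
  isCover : IsCover U
  contractible : ∀ (k : ℕ) (a : Fin (k + 1) → A), (inter U a).Nonempty →
    ContractibleSpace (inter U a)

/-- The tuples `(α₀, …, αₖ)` with `U_{α₀} ∩ ⋯ ∩ U_{αₖ}` nonempty. -/
abbrev Simplex (U : A → Opens M) (k : ℕ) : Type _ :=
  {a : Fin (k + 1) → A // (inter U a).Nonempty}

/-- The face `(α₀, …, α̂ᵢ, …, αₖ₊₁)`, with the `i`-th index omitted. -/
def Simplex.face {U : A → Opens M} {k : ℕ} (a : Simplex U (k + 1)) (i : Fin (k + 2)) :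
    Simplex U k :=
  ⟨fun j => a.1 (i.succAbove j), a.2.mono fun _ hx =>
    Set.mem_iInter.2 fun j => Set.mem_iInter.1 hx (i.succAbove j)⟩

variable (U : A → Opens M) (k : ℕ) (G : Type*) [AddCommGroup G]

/-- The group of Čech `k`-cochains of the cover `U` with values in the abelian group `G`. -/
abbrev Cochain : Type _ := Simplex U k → G

/-- The Čech coboundary operator
`(δσ)_{α₀…αₖ₊₁} = ∑ᵢ (-1)ⁱ σ_{α₀…α̂ᵢ…αₖ₊₁}`. -/
def coboundary : Cochain U k G →+ Cochain U (k + 1) G where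
  toFun σ a := ∑ i : Fin (k + 2), (-1 : ℤ) ^ (i : ℕ) • σ (a.face i)
  map_zero' := by ext a; simp
  map_add' σ τ := by ext a; simp [Finset.sum_add_distrib]

/-- Čech cocycles. -/
def cocycles : AddSubgroup (Cochain U k G) := (coboundary U k G).ker

/-- Čech coboundaries; there are no nonzero ones in degree `0`. -/
def coboundaries : (k : ℕ) → AddSubgroup (Cochain U k G)
  | 0 => ⊥
  | k + 1 => (coboundary U k G).range

/-- The Čech cohomology group of the cover `U`: cocycles modulo coboundaries. -/
abbrev Cohomology : Type _ :=
  cocycles U k G ⧸ (coboundaries U G k).addSubgroupOf (cocycles U k G)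

variable {U k G}

/-- The cohomology class of a cocycle. -/
def Cohomology.mk (c : cocycles U k G) : Cohomology U k G := QuotientAddGroup.mk c

section Refinement

variable {C : Type*} {W : C → Opens M} (r : C → A) (hr : ∀ i, W i ≤ U (r i))

/-- The simplex of `U` determined by a simplex of a refinement `W`. -/
def Simplex.map (a : Simplex W k) : Simplex U k :=
  ⟨fun j => r (a.1 j), a.2.mono fun _ hx =>
    Set.mem_iInter.2 fun j => hr _ (Set.mem_iInter.1 hx j)⟩

variable (k G)

/-- Restriction of cochains along a refinement. -/
def restrictCochain : Cochain U k G →+ Cochain W k G where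
  toFun σ a := σ (a.map r hr)
  map_zero' := rfl
  map_add' _ _ := rfl

theorem coboundary_restrict (σ : Cochain U k G) :
    coboundary W k G (restrictCochain k G r hr σ) =
      restrictCochain (k + 1) G r hr (coboundary U k G σ) := rfl

theorem restrict_mem_cocycles (σ : cocycles U k G) :
    restrictCochain k G r hr σ.1 ∈ cocycles W k G := by
  have h : coboundary U k G σ.1 = 0 := σ.2
  change coboundary W k G _ = 0
  rw [coboundary_restrict, h, map_zero]

/-- Restriction of cocycles along a refinement. -/
def restrictCocycle : cocycles U k G →+ cocycles W k G where
  toFun σ := ⟨restrictCochain k G r hr σ.1, restrict_mem_cocycles k G r hr σ⟩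
  map_zero' := rfl
  map_add' _ _ := rfl

theorem restrict_coboundaries :
    (coboundaries U G k).addSubgroupOf (cocycles U k G) ≤
      ((coboundaries W G k).addSubgroupOf (cocycles W k G)).comap
        (restrictCocycle k G r hr) := by
  intro σ hσ
  rw [AddSubgroup.mem_addSubgroupOf] at hσ
  rw [AddSubgroup.mem_comap, AddSubgroup.mem_addSubgroupOf]
  cases k with
  | zero =>
    have h : σ.1 = 0 := hσ
    change restrictCochain 0 G r hr σ.1 = 0
    rw [h, map_zero]
  | succ k =>
    obtain ⟨τ, hτ⟩ := hσ
    refine ⟨restrictCochain k G r hr τ, ?_⟩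
    rw [coboundary_restrict, hτ]
    rfl

/-- Restriction of Čech cohomology classes along a refinement. -/
def restrict : Cohomology U k G →+ Cohomology W k G :=
  QuotientAddGroup.map _ _ (restrictCocycle k G r hr) (restrict_coboundaries k G r hr)

end Refinement

/-- Classes on two open covers of `M` agree if they have the same restriction to some common
refinement, i.e. if they define the same element of the direct limit of the Čech cohomology
groups over all open covers of `M`. (Open covers indexed by the points of `M` are cofinal: any
cover has a subfamily of this form, obtained by choosing a member around each point.) -/
def Agree {M : Type*} [TopologicalSpace M] {A B : Type*} {U : A → Opens M} {V : B → Opens M}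
    {k : ℕ} {G : Type*} [AddCommGroup G] (c : Cohomology U k G) (d : Cohomology V k G) : Prop :=
  ∃ (W : M → Opens M) (_ : IsCover W) (r : M → A) (hr : ∀ i, W i ≤ U (r i))
    (s : M → B) (hs : ∀ i, W i ≤ V (s i)),
    restrict k G r hr c = restrict k G s hs d

end Cech

/-! ## Orientability -/

variable (n : ℕ) (M : Type*) [TopologicalSpace M] [ChartedSpace (EuclideanSpace ℝ (Fin n)) M]

/-- `M` is orientable: there is a choice of orientations of the tangent spaces which is continuous,
i.e. each point has an open neighbourhood carrying a continuous tangent frame that induces the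
chosen orientation at every point. -/
def IsOrientable [IsManifold (𝓡 n) ∞ M] : Prop :=
  ∃ o : ∀ x : M, Orientation ℝ (TangentSpace (𝓡 n) x) (Fin n),
    ∀ x : M, ∃ U : Opens M, x ∈ U ∧
      ∃ b : ∀ y : U, Module.Basis (Fin n) ℝ (TangentSpace (𝓡 n) (y : M)),
        (∀ i, Continuous fun y : U => (⟨(y : M), b y i⟩ : TangentBundle (𝓡 n) M)) ∧
        ∀ y : U, (b y).orientation = o (y : M)

/-! ## Orthonormal frames and the first Stiefel-Whitney class -/

/-- Smooth Riemannian metrics on `M`. -/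
abbrev RiemannianMetricOn [IsManifold (𝓡 n) ∞ M] : Type _ :=
  ContMDiffRiemannianMetric (𝓡 n) ∞ (EuclideanSpace ℝ (Fin n))
    (fun x : M => TangentSpace (𝓡 n) x)

variable {n M} [IsManifold (𝓡 n) ∞ M]

/-- The fibre at `x` of the orthonormal frame bundle of `(M, g)`: linear isometries
`e : (ℝⁿ, standard) → (T_x M, g_x)`. -/
structure OrthonormalFrame (g : RiemannianMetricOn n M) (x : M) where
  toLinearEquiv : EuclideanSpace ℝ (Fin n) ≃ₗ[ℝ] TangentSpace (𝓡 n) x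
  isometry : ∀ v w, g.inner x (toLinearEquiv v) (toLinearEquiv w) = inner ℝ v w

/-- The element `f⁻¹ ∘ e` of the isometry group of `ℝⁿ` relating two orthonormal frames. -/
def OrthonormalFrame.relIsometry {g : RiemannianMetricOn n M} {x : M}
    (e f : OrthonormalFrame g x) :
    EuclideanSpace ℝ (Fin n) ≃ₗᵢ[ℝ] EuclideanSpace ℝ (Fin n) :=
  (e.toLinearEquiv.trans f.toLinearEquiv.symm).isometryOfInner fun v w => by
    rw [← f.isometry, ← e.isometry]
    simp

/-- The orthogonal matrix of `f⁻¹ ∘ e`. -/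
def OrthonormalFrame.relMatrix {g : RiemannianMetricOn n M} {x : M}
    (e f : OrthonormalFrame g x) : Matrix.orthogonalGroup (Fin n) ℝ :=
  ⟨LinearMap.toMatrix (EuclideanSpace.basisFun (Fin n) ℝ).toBasis
      (EuclideanSpace.basisFun (Fin n) ℝ).toBasis (e.relIsometry f).toLinearEquiv.toLinearMap,
    LinearIsometryEquiv.toMatrix_mem_unitaryGroup (e.relIsometry f)
      (EuclideanSpace.basisFun (Fin n) ℝ) (EuclideanSpace.basisFun (Fin n) ℝ)⟩

/-- A trivializing open cover, with local trivializations, of the orthonormal frame bundle of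
`(M, g)`. An equivariant trivialization of this principal `O(n)`-bundle over `U α` is the same
thing as a smooth section of it over `U α` (the inverse image of `(x, 1)`), that is, a smooth
orthonormal frame; this is how it is recorded. -/
structure FrameCover (g : RiemannianMetricOn n M) (A : Type*) where
  U : A → Opens M
  isCover : Cech.IsCover U
  frame : ∀ (α : A) (x : U α), OrthonormalFrame g (x : M)
  smooth : ∀ (α : A) (v : EuclideanSpace ℝ (Fin n)),
    ContMDiff (𝓡 n) (𝓡 n).tangent ∞
      (fun x : U α => (⟨(x : M), (frame α x).toLinearEquiv v⟩ : TangentBundle (𝓡 n) M))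

/-- The determinant `±1` of an orthogonal matrix, as an element of the group `{±1}`. -/
def orthogonalDet (Q : Matrix.orthogonalGroup (Fin n) ℝ) : ℤˣ :=
  if Q.1.det = 1 then 1 else -1

theorem orthogonalDet_coe (Q : Matrix.orthogonalGroup (Fin n) ℝ) :
    ((orthogonalDet Q : ℤ) : ℝ) = Q.1.det := by
  have h : Q.1.det * Q.1.det = 1 := by
    simpa using (Unitary.mem_iff.1 (Matrix.det_of_mem_unitary Q.2)).2
  unfold orthogonalDet
  split_ifs with h1
  · simp [h1]
  · rcases mul_self_eq_one_iff.1 h with h2 | h2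
    · exact absurd h2 h1
    · simp [h2]

theorem orthogonalDet_relMatrix {g : RiemannianMetricOn n M} {x : M}
    (e f : OrthonormalFrame g x) :
    ((orthogonalDet (e.relMatrix f) : ℤ) : ℝ) =
      LinearMap.det (e.relIsometry f).toLinearEquiv.toLinearMap := by
  rw [orthogonalDet_coe]
  exact LinearMap.det_toMatrix _ _

theorem orthogonalDet_comp {g : RiemannianMetricOn n M} {x : M}
    (e f h : OrthonormalFrame g x) :
    orthogonalDet (e.relMatrix h) =
      orthogonalDet (f.relMatrix h) * orthogonalDet (e.relMatrix f) := by
  have : ((orthogonalDet (e.relMatrix h) : ℤ) : ℝ) =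
      ((orthogonalDet (f.relMatrix h) * orthogonalDet (e.relMatrix f) : ℤˣ) : ℤ) := by
    push_cast
    rw [orthogonalDet_relMatrix, orthogonalDet_relMatrix, orthogonalDet_relMatrix,
      ← LinearMap.det_comp]
    congr 1
    ext v
    simp [OrthonormalFrame.relIsometry]
  exact Units.ext (by exact_mod_cast this)

namespace FrameCover

variable {g : RiemannianMetricOn n M} {A : Type*} (T : FrameCover g A)

/-- The transition functions `g_{αβ} : U α ∩ U β → O(n)`: the value at `x` is
the matrix of `ψ_β ∘ ψ_α⁻¹` at `x`, where `ψ_α` is the inverse of the frame over `U α`. -/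
def transition (α β : A) (x : M) (hα : x ∈ T.U α) (hβ : x ∈ T.U β) :
    Matrix.orthogonalGroup (Fin n) ℝ :=
  (T.frame α ⟨x, hα⟩).relMatrix (T.frame β ⟨x, hβ⟩)

theorem transition_apply (α β : A) (x : M) (hα : x ∈ T.U α) (hβ : x ∈ T.U β) (i j : Fin n) :
    (T.transition α β x hα hβ).1 i j =
      g.inner x ((T.frame β ⟨x, hβ⟩).toLinearEquiv (EuclideanSpace.basisFun (Fin n) ℝ i))
        ((T.frame α ⟨x, hα⟩).toLinearEquiv (EuclideanSpace.basisFun (Fin n) ℝ j)) := by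
  have h := (T.frame β ⟨x, hβ⟩).isometry (EuclideanSpace.basisFun (Fin n) ℝ i)
    ((T.frame β ⟨x, hβ⟩).toLinearEquiv.symm
      ((T.frame α ⟨x, hα⟩).toLinearEquiv (EuclideanSpace.basisFun (Fin n) ℝ j)))
  rw [LinearEquiv.apply_symm_apply] at h
  rw [h]
  simp only [transition, OrthonormalFrame.relMatrix, LinearMap.toMatrix_apply]
  rw [OrthonormalBasis.coe_toBasis, OrthonormalBasis.coe_toBasis_repr_apply,
    OrthonormalBasis.repr_apply_apply]
  rfl

/-- The determinants of the transition functions are continuous. -/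
theorem continuous_det_transition (α β : A) :
    Continuous fun x : (T.U α ⊓ T.U β : Opens M) =>
      (T.transition α β x x.2.1 x.2.2).1.det := by
  refine Continuous.matrix_det (continuous_matrix fun i j => ?_)
  simp only [transition_apply]
  have hv := (T.smooth β (EuclideanSpace.basisFun (Fin n) ℝ i)).continuous.comp
    (Opens.isOpenEmbedding_of_le (inf_le_right : T.U α ⊓ T.U β ≤ T.U β)).continuous
  have hw := (T.smooth α (EuclideanSpace.basisFun (Fin n) ℝ j)).continuous.comp
    (Opens.isOpenEmbedding_of_le (inf_le_left : T.U α ⊓ T.U β ≤ T.U α)).continuous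
  let _ : RiemannianBundle (fun x : M => TangentSpace (𝓡 n) x) := ⟨g.toRiemannianMetric⟩
  have : IsContinuousRiemannianBundle (EuclideanSpace ℝ (Fin n))
      (fun x : M => TangentSpace (𝓡 n) x) :=
    ⟨g.inner, g.contMDiff.continuous, fun _ _ _ => rfl⟩
  exact Continuous.inner_bundle (F := EuclideanSpace ℝ (Fin n))
    (E := fun x : M => TangentSpace (𝓡 n) x)
    (b := fun x : (T.U α ⊓ T.U β : Opens M) => (x : M)) hv hw

/-- On a good cover the determinants of the transition functions are constant. -/
theorem orthogonalDet_transition_const (hT : Cech.IsGoodCover T.U) (α β : A) (x y : M)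
    (hxα : x ∈ T.U α) (hxβ : x ∈ T.U β) (hyα : y ∈ T.U α) (hyβ : y ∈ T.U β) :
    orthogonalDet (T.transition α β x hxα hxβ) = orthogonalDet (T.transition α β y hyα hyβ) := by
  have hset : Cech.inter T.U ![α, β] = ((T.U α ⊓ T.U β : Opens M) : Set M) := by
    ext z
    simp [Cech.inter, Fin.forall_fin_two]
  have hc : ContractibleSpace (T.U α ⊓ T.U β : Opens M) := by
    have := hT.contractible 1 ![α, β] (by rw [hset]; exact ⟨x, hxα, hxβ⟩)
    rw [hset] at this
    exact this
  have hd : ∀ z : (T.U α ⊓ T.U β : Opens M),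
      (T.transition α β z z.2.1 z.2.2).1.det ∈ ({1, -1} : Set ℝ) := fun z => by
    rw [← orthogonalDet_coe]
    rcases Int.units_eq_one_or (orthogonalDet (T.transition α β z z.2.1 z.2.2)) with h | h <;>
      simp [h]
  have hdisc : IsDiscrete ({1, -1} : Set ℝ) := Set.Finite.isDiscrete (by simp)
  have h := isPreconnected_univ.constant_of_mapsTo (S := Set.univ) (T := ({1, -1} : Set ℝ)) hdisc
    (T.continuous_det_transition α β).continuousOn (fun z _ => hd z)
    (Set.mem_univ ⟨x, hxα, hxβ⟩) (Set.mem_univ ⟨y, hyα, hyβ⟩)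
  unfold orthogonalDet
  rw [h]

/-- The Čech `1`-cochain `c_{αβ} = det g_{αβ} ∈ {±1}` of a trivializing cover. It is evaluated at
some point of `U α ∩ U β`; on a good cover the value does not depend on the point. -/
def detCochain : Cech.Cochain T.U 1 (Additive ℤˣ) := fun a =>
  Additive.ofMul (orthogonalDet (T.transition (a.1 0) (a.1 1) a.2.some
    (Set.mem_iInter.1 a.2.some_mem 0) (Set.mem_iInter.1 a.2.some_mem 1)))

theorem detCochain_apply (hT : Cech.IsGoodCover T.U) (a : Cech.Simplex T.U 1) (x : M)
    (h0 : x ∈ T.U (a.1 0)) (h1 : x ∈ T.U (a.1 1)) :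
    T.detCochain a = Additive.ofMul (orthogonalDet (T.transition (a.1 0) (a.1 1) x h0 h1)) :=
  congrArg Additive.ofMul (T.orthogonalDet_transition_const hT _ _ _ _ _ _ _ _)

theorem detCochain_mem_cocycles (hT : Cech.IsGoodCover T.U) :
    T.detCochain ∈ Cech.cocycles T.U 1 (Additive ℤˣ) := by
  change Cech.coboundary T.U 1 (Additive ℤˣ) T.detCochain = 0
  funext a
  obtain ⟨x, hx⟩ := a.2
  have h0 : x ∈ T.U (a.1 0) := Set.mem_iInter.1 hx 0
  have h1 : x ∈ T.U (a.1 1) := Set.mem_iInter.1 hx 1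
  have h2 : x ∈ T.U (a.1 2) := Set.mem_iInter.1 hx 2
  change ∑ i : Fin 3, (-1 : ℤ) ^ (i : ℕ) • T.detCochain (a.face i) = 0
  rw [Fin.sum_univ_three, T.detCochain_apply hT (a.face 0) x h1 h2,
    T.detCochain_apply hT (a.face 1) x h0 h2, T.detCochain_apply hT (a.face 2) x h0 h1]
  have h := orthogonalDet_comp (T.frame _ ⟨x, h0⟩) (T.frame _ ⟨x, h1⟩) (T.frame _ ⟨x, h2⟩)
  change (-1 : ℤ) ^ 0 • Additive.ofMul (orthogonalDet (T.transition (a.1 1) (a.1 2) x h1 h2)) +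
    (-1 : ℤ) ^ 1 • Additive.ofMul (orthogonalDet (T.transition (a.1 0) (a.1 2) x h0 h2)) +
    (-1 : ℤ) ^ 2 • Additive.ofMul (orthogonalDet (T.transition (a.1 0) (a.1 1) x h0 h1)) = 0
  have h' : orthogonalDet (T.transition (a.1 0) (a.1 2) x h0 h2) =
    orthogonalDet (T.transition (a.1 1) (a.1 2) x h1 h2) *
      orthogonalDet (T.transition (a.1 0) (a.1 1) x h0 h1) := h
  rw [h', ofMul_mul]
  simp

/-- The first Stiefel-Whitney class `w₁(M) = [c]`, the class of `c_{αβ} = det g_{αβ}` in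
`H¹(M, ℤ₂)`, computed as the Čech cohomology of a good trivializing cover of the orthonormal
frame bundle; `ℤ₂` is the group `{±1}`. -/
def w₁ (hT : Cech.IsGoodCover T.U) : Cech.Cohomology T.U 1 (Additive ℤˣ) :=
  Cech.Cohomology.mk ⟨T.detCochain, T.detCochain_mem_cocycles hT⟩

end FrameCover

end

/-!
The class `w₁` measures the failure of the frames `e_α` to be coherently oriented. A frame `e_α(x)`
orients `T_x M`, and `c_{αβ} = det g_{αβ}` is the sign `±1` by which the orientations of `e_α` and
`e_β` differ (`OrthonormalFrame.orthogonalDet_relMatrix_eq_relSign`). Such signs multiply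
(`Orientation.relSign_mul_relSign`), so everything reduces to the analysis of one function: the
sign by which the orientation of `e_α(x)` differs from that of another continuous frame `b(x)`. It
is locally constant, because the matrix of `b` in the orthonormal frame `e_α` has the continuous
entries `g((e_α)_i, b_j)`, and its determinant does not vanish
(`FrameCover.isLocallyConstant_relSign`).

*Independence.* Given a second cover with frames `e'`, possibly orthonormal for another metric,
shrink around each point `x` to an open set `W x ⊆ U_{r x} ∩ V_{s x}` on which the sign `σ_x`
between `e_{r x}` and `e'_{s x}` is constant. On this refinement `c' - c` is the coboundary of `σ`.

*Orientability.* The equation `w₁ = 0` says that `c_{αβ} = τ_α τ_β` for some signs `τ_α`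
(`FrameCover.w₁_eq_zero_iff`). If so, the orientations `τ_α • [e_α]` agree on overlaps and orient
`M`. Conversely, for an orientation `o` of `M` the sign between `e_α` and `o` is locally constant
on the connected set `U_α`, hence is a constant `τ_α`. Dimension `0` needs care in the first
implication: there a frame induces only the positive orientation, so signs `τ_α` are unusable, and
also unnecessary.
-/

noncomputable section

open Module

/-! ### The sign between two orientations -/

namespace Orientation

variable {V : Type*} [AddCommGroup V] [Module ℝ V] {n : ℕ}

open Classical in
/-- The sign by which two orientations of a vector space differ. -/
def relSign (o o' : Orientation ℝ V (Fin n)) : ℤˣ := if o = o' then 1 else -1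

theorem relSign_eq_one_iff {o o' : Orientation ℝ V (Fin n)} : relSign o o' = 1 ↔ o = o' := by
  unfold relSign
  split_ifs with h <;> simp [h]

theorem relSign_comm (o o' : Orientation ℝ V (Fin n)) : relSign o o' = relSign o' o := by
  by_cases h : o = o' <;> simp [relSign, h, eq_comm]

theorem relSign_self (o : Orientation ℝ V (Fin n)) : relSign o o = 1 := by
  simp [relSign]

/-- The basis ensures that `V` has dimension `n`, so that there are only two orientations. -/
theorem relSign_mul_relSign (e : Basis (Fin n) ℝ V) (o₁ o₂ o₃ : Orientation ℝ V (Fin n)) :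
    relSign o₁ o₂ * relSign o₂ o₃ = relSign o₁ o₃ := by
  have h := Module.Ray.ne_neg_self e.orientation
  rcases e.orientation_eq_or_eq_neg o₁ with rfl | rfl <;>
  rcases e.orientation_eq_or_eq_neg o₂ with rfl | rfl <;>
  rcases e.orientation_eq_or_eq_neg o₃ with rfl | rfl <;>
  simp [relSign, h, h.symm]

theorem relSign_orientation_eq_one_iff (e f : Basis (Fin n) ℝ V) :
    relSign e.orientation f.orientation = 1 ↔ 0 < e.det f := by
  rw [relSign_eq_one_iff, e.orientation_eq_iff_det_pos]

end Orientation

open Orientation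

/-- In positive dimension a basis can be given any orientation; `s` is its sign relative to `e`. -/
theorem Module.Basis.exists_relSign_orientation_eq {V : Type*} [AddCommGroup V] [Module ℝ V]
    {n : ℕ} [Nonempty (Fin n)] (e : Basis (Fin n) ℝ V) (s : ℤˣ) :
    ∃ b : Basis (Fin n) ℝ V, relSign b.orientation e.orientation = s := by
  rcases Int.units_eq_one_or s with rfl | rfl
  · exact ⟨e, relSign_self _⟩
  · refine ⟨e.adjustToOrientation (-e.orientation), ?_⟩
    rw [e.orientation_adjustToOrientation, relSign, if_neg (Module.Ray.ne_neg_self _).symm]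

theorem Orientation.relSign_map {V V' : Type*} [AddCommGroup V] [Module ℝ V] [AddCommGroup V']
    [Module ℝ V'] {n : ℕ} (f : V ≃ₗ[ℝ] V') (o o' : Orientation ℝ V (Fin n)) :
    relSign (Orientation.map (Fin n) f o) (Orientation.map (Fin n) f o') = relSign o o' := by
  by_cases h : o = o' <;> simp [relSign, h]

/-! ### Čech cochains in low degrees -/

namespace Cech

variable {M : Type*} [TopologicalSpace M] {A : Type*} {U : A → Opens M} {G : Type*}
  [AddCommGroup G]

/-- The vertex `α` of the nerve of `U` determined by a point of `U α`. -/
def Simplex.vertex (α : A) {x : M} (hx : x ∈ U α) : Simplex U 0 :=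
  ⟨fun _ => α, x, Set.mem_iInter.2 fun _ => hx⟩

/-- The edge `(α, β)` of the nerve of `U` determined by a point of `U α ∩ U β`. -/
def Simplex.edge (α β : A) {x : M} (hα : x ∈ U α) (hβ : x ∈ U β) : Simplex U 1 :=
  ⟨![α, β], x, Set.mem_iInter.2 (Fin.forall_fin_two.2 ⟨hα, hβ⟩)⟩

theorem coboundary_zero_apply (σ : Cochain U 0 G) (a : Simplex U 1) :
    coboundary U 0 G σ a = σ (a.face 0) - σ (a.face 1) := by
  change ∑ i : Fin 2, (-1 : ℤ) ^ (i : ℕ) • σ (a.face i) = _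
  simp [Fin.sum_univ_two, sub_eq_add_neg]

theorem Simplex.face_zero_edge (α β : A) {x : M} (hα : x ∈ U α) (hβ : x ∈ U β) :
    (Simplex.edge α β hα hβ).face 0 = Simplex.vertex β hβ :=
  Subtype.ext (funext fun j => by fin_cases j; rfl)

theorem Simplex.face_one_edge (α β : A) {x : M} (hα : x ∈ U α) (hβ : x ∈ U β) :
    (Simplex.edge α β hα hβ).face 1 = Simplex.vertex α hα :=
  Subtype.ext (funext fun j => by fin_cases j; rfl)

theorem Cohomology.mk_eq_zero_iff (c : cocycles U 1 G) :
    Cohomology.mk c = 0 ↔ ∃ σ, coboundary U 0 G σ = c.1 :=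
  (QuotientAddGroup.eq_zero_iff c).trans AddSubgroup.mem_addSubgroupOf

theorem Cohomology.mk_eq_mk_of_coboundary {c d : cocycles U 1 G} (σ : Cochain U 0 G)
    (h : coboundary U 0 G σ = d.1 - c.1) : Cohomology.mk c = Cohomology.mk d := by
  refine QuotientAddGroup.eq.2 (AddSubgroup.mem_addSubgroupOf.2 ⟨σ, ?_⟩)
  rw [h, sub_eq_neg_add]
  rfl

end Cech

/-! ### Orientations induced by orthonormal frames -/

variable {n : ℕ} {M : Type*} [TopologicalSpace M] [ChartedSpace (EuclideanSpace ℝ (Fin n)) M]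
  [IsManifold (𝓡 n) ∞ M]

namespace OrthonormalFrame

variable {g : RiemannianMetricOn n M} {x : M}

/-- The basis of `T_x M` that is the image of the standard basis of `ℝⁿ`. -/
def basis (e : OrthonormalFrame g x) : Basis (Fin n) ℝ (TangentSpace (𝓡 n) x) :=
  (EuclideanSpace.basisFun (Fin n) ℝ).toBasis.map e.toLinearEquiv

/-- The orientation of `T_x M` induced by an orthonormal frame. -/
def orientation (e : OrthonormalFrame g x) : Orientation ℝ (TangentSpace (𝓡 n) x) (Fin n) :=
  e.basis.orientation

theorem basis_apply (e : OrthonormalFrame g x) (i : Fin n) :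
    e.basis i = e.toLinearEquiv (EuclideanSpace.basisFun (Fin n) ℝ i) := by
  simp [basis]

theorem basis_repr_apply (e : OrthonormalFrame g x) (v : TangentSpace (𝓡 n) x) (i : Fin n) :
    e.basis.repr v i = g.inner x (e.basis i) v := by
  obtain ⟨w, rfl⟩ := e.toLinearEquiv.surjective v
  rw [basis_apply, e.isometry, ← OrthonormalBasis.repr_apply_apply]
  simp [basis]

theorem basis_det_apply (e : OrthonormalFrame g x) (v : Fin n → TangentSpace (𝓡 n) x) :
    e.basis.det v = (Matrix.of fun i j => g.inner x (e.basis i) (v j)).det := by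
  rw [Basis.det_apply]
  congr 1
  ext i j
  exact e.basis_repr_apply _ _

theorem basis_det_basis (e f : OrthonormalFrame g x) :
    f.basis.det e.basis = (e.relMatrix f).1.det := by
  rw [Basis.det_apply]
  congr 1
  ext i j
  simp [basis, relMatrix, relIsometry, LinearMap.toMatrix_apply, Basis.toMatrix_apply]

theorem orthogonalDet_relMatrix_eq_relSign (e f : OrthonormalFrame g x) :
    orthogonalDet (e.relMatrix f) = relSign e.orientation f.orientation := by
  have h : orthogonalDet (e.relMatrix f) = 1 ↔ relSign f.orientation e.orientation = 1 := by
    rw [orientation, orientation, relSign_orientation_eq_one_iff, basis_det_basis,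
      ← orthogonalDet_coe]
    rcases Int.units_eq_one_or (orthogonalDet (e.relMatrix f)) with h | h <;> rw [h] <;> norm_num
  rw [relSign_comm]
  rcases Int.units_eq_one_or (orthogonalDet (e.relMatrix f)) with h1 | h1
  · rw [h1, h.1 h1]
  · rcases Int.units_eq_one_or (relSign f.orientation e.orientation) with h2 | h2
    · rw [h.2 h2, h2]
    · rw [h1, h2]

end OrthonormalFrame

namespace FrameCover

variable {g g' : RiemannianMetricOn n M} {A B : Type*} (T : FrameCover g A) (T' : FrameCover g' B)

theorem orthogonalDet_transition (α β : A) (x : M) (hα : x ∈ T.U α) (hβ : x ∈ T.U β) :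
    orthogonalDet (T.transition α β x hα hβ) =
      relSign (T.frame α ⟨x, hα⟩).orientation (T.frame β ⟨x, hβ⟩).orientation :=
  OrthonormalFrame.orthogonalDet_relMatrix_eq_relSign _ _

/-- The frames of `b` are parametrized by a space `N` over `U α`, so that the lemma applies to
frames given on subsets of `M` only. -/
theorem isLocallyConstant_relSign (α : A) {N : Type*} [TopologicalSpace N] {p : N → T.U α}
    (hp : Continuous p) (b : ∀ y, Basis (Fin n) ℝ (TangentSpace (𝓡 n) (p y : M)))
    (hb : ∀ i, Continuous fun y => (⟨(p y : M), b y i⟩ : TangentBundle (𝓡 n) M)) :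
    IsLocallyConstant fun y => relSign (T.frame α (p y)).orientation (b y).orientation := by
  have hdet : Continuous fun y => (T.frame α (p y)).basis.det (b y) := by
    simp only [OrthonormalFrame.basis_det_apply, OrthonormalFrame.basis_apply]
    refine Continuous.matrix_det (continuous_matrix fun i j => ?_)
    have hv := (T.smooth α (EuclideanSpace.basisFun (Fin n) ℝ i)).continuous.comp hp
    let _ : RiemannianBundle (fun x : M => TangentSpace (𝓡 n) x) := ⟨g.toRiemannianMetric⟩
    have : IsContinuousRiemannianBundle (EuclideanSpace ℝ (Fin n))
        (fun x : M => TangentSpace (𝓡 n) x) :=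
      ⟨g.inner, g.contMDiff.continuous, fun _ _ _ => rfl⟩
    exact Continuous.inner_bundle (F := EuclideanSpace ℝ (Fin n))
      (E := fun x : M => TangentSpace (𝓡 n) x) (b := fun y => (p y : M)) hv (hb j)
  have hne : ∀ y, (T.frame α (p y)).basis.det (b y) ≠ 0 := fun y =>
    ((T.frame α (p y)).basis.isUnit_det (b y)).ne_zero
  have hone : IsClopen {y | relSign (T.frame α (p y)).orientation (b y).orientation = 1} := by
    simp only [OrthonormalFrame.orientation, relSign_orientation_eq_one_iff]
    refine ⟨?_, isOpen_lt continuous_const hdet⟩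
    -- The determinant does not vanish, so its positivity is also the closed condition `0 ≤ det`.
    have : {y | 0 < (T.frame α (p y)).basis.det (b y)} =
        {y | 0 ≤ (T.frame α (p y)).basis.det (b y)} :=
      Set.ext fun y => ((hne y).symm.le_iff_lt).symm
    rw [this]
    exact isClosed_le continuous_const hdet
  refine IsLocallyConstant.iff_isOpen_fiber.2 fun s => ?_
  rcases Int.units_eq_one_or s with rfl | rfl
  · exact hone.isOpen
  · convert hone.compl.isOpen using 1
    ext y
    rcases Int.units_eq_one_or (relSign (T.frame α (p y)).orientation (b y).orientation) with
      h | h <;> simp [h]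

/-! ### Independence of the cover, the frames and the metric -/

/-- Around each point the frames of two trivializing covers differ by a constant sign. -/
theorem exists_opens_relSign_eq (α : A) (β : B) (x : M) (hα : x ∈ T.U α) (hβ : x ∈ T'.U β) :
    ∃ W : Opens M, x ∈ W ∧ ∃ (h : W ≤ T.U α) (h' : W ≤ T'.U β), ∀ y (hy : y ∈ W),
      relSign (T.frame α ⟨y, h hy⟩).orientation (T'.frame β ⟨y, h' hy⟩).orientation =
        relSign (T.frame α ⟨x, hα⟩).orientation (T'.frame β ⟨x, hβ⟩).orientation := by
  have hlc := T.isLocallyConstant_relSign α (N := (T.U α ⊓ T'.U β : Opens M))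
    (p := fun y => ⟨y, y.2.1⟩) (by fun_prop) (fun y => (T'.frame β ⟨y, y.2.2⟩).basis) fun i => by
      simp only [OrthonormalFrame.basis_apply]
      exact (T'.smooth β (EuclideanSpace.basisFun (Fin n) ℝ i)).continuous.comp
        (Opens.isOpenEmbedding_of_le (inf_le_right : T.U α ⊓ T'.U β ≤ T'.U β)).continuous
  obtain ⟨O, hO, hxO, hconst⟩ := hlc.exists_open ⟨x, hα, hβ⟩
  refine ⟨⟨_, (T.U α ⊓ T'.U β).isOpen.isOpenMap_subtype_val O hO⟩, ⟨_, hxO, rfl⟩, ?_, ?_, ?_⟩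
  · rintro _ ⟨y, -, rfl⟩
    exact y.2.1
  · rintro _ ⟨y, -, rfl⟩
    exact y.2.2
  · rintro _ ⟨y, hy, rfl⟩
    exact hconst y hy

theorem agree_w₁ (hT : Cech.IsGoodCover T.U) (hT' : Cech.IsGoodCover T'.U) :
    Cech.Agree (T.w₁ hT) (T'.w₁ hT') := by
  choose r hr using T.isCover
  choose s hs using T'.isCover
  choose W hW hWr hWs hconst using fun x => T.exists_opens_relSign_eq T' (r x) (s x) x (hr x) (hs x)
  refine ⟨W, fun x => ⟨x, hW x⟩, r, hWr, s, hWs, ?_⟩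
  refine Cech.Cohomology.mk_eq_mk_of_coboundary
    (fun a => Additive.ofMul (relSign (T.frame (r (a.1 0)) ⟨a.1 0, hr _⟩).orientation
      (T'.frame (s (a.1 0)) ⟨a.1 0, hs _⟩).orientation)) ?_
  funext a
  obtain ⟨x, hx⟩ := a.2
  have h0 : x ∈ W (a.1 0) := Set.mem_iInter.1 hx 0
  have h1 : x ∈ W (a.1 1) := Set.mem_iInter.1 hx 1
  rw [Cech.coboundary_zero_apply]
  have hc : (Cech.restrictCochain 1 (Additive ℤˣ) r hWr T.detCochain) a =
      Additive.ofMul (orthogonalDet (T.transition (r (a.1 0)) (r (a.1 1)) x _ _)) :=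
    T.detCochain_apply hT (a.map r hWr) x (hWr _ h0) (hWr _ h1)
  have hc' : (Cech.restrictCochain 1 (Additive ℤˣ) s hWs T'.detCochain) a =
      Additive.ofMul (orthogonalDet (T'.transition (s (a.1 0)) (s (a.1 1)) x _ _)) :=
    T'.detCochain_apply hT' (a.map s hWs) x (hWs _ h0) (hWs _ h1)
  rw [orthogonalDet_transition] at hc hc'
  have e0 := hconst _ x h0
  have e1 := hconst _ x h1
  change Additive.ofMul (relSign (T.frame (r (a.1 1)) ⟨a.1 1, hr _⟩).orientation
      (T'.frame (s (a.1 1)) ⟨a.1 1, hs _⟩).orientation) -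
    Additive.ofMul (relSign (T.frame (r (a.1 0)) ⟨a.1 0, hr _⟩).orientation
      (T'.frame (s (a.1 0)) ⟨a.1 0, hs _⟩).orientation) =
    (Cech.restrictCochain 1 (Additive ℤˣ) s hWs T'.detCochain) a -
    (Cech.restrictCochain 1 (Additive ℤˣ) r hWr T.detCochain) a
  rw [hc, hc', ← e0, ← e1, sub_eq_sub_iff_add_eq_add, ← ofMul_mul, ← ofMul_mul]
  congr 1
  -- Both sides are the sign between `e_{r a₀}` and `e'_{s a₁}` at `x`.
  have e := (T.frame (r (a.1 0)) ⟨x, hWr _ h0⟩).basis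
  exact ((mul_comm _ _).trans (relSign_mul_relSign e _ _ _)).trans
    ((mul_comm _ _).trans (relSign_mul_relSign e _ _ _)).symm

/-! ### Vanishing of the class and orientability -/

theorem w₁_eq_zero_iff (hT : Cech.IsGoodCover T.U) :
    T.w₁ hT = 0 ↔ ∃ τ : A → ℤˣ, ∀ α β x (hα : x ∈ T.U α) (hβ : x ∈ T.U β),
      relSign (T.frame α ⟨x, hα⟩).orientation (T.frame β ⟨x, hβ⟩).orientation = τ α * τ β := by
  refine (Cech.Cohomology.mk_eq_zero_iff _).trans ⟨?_, ?_⟩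
  · rintro ⟨σ, hσ⟩
    classical
    -- Indices of empty members of the cover are not vertices; their sign is irrelevant.
    refine ⟨fun α => if h : ∃ x, x ∈ T.U α then
      (σ (Cech.Simplex.vertex α h.choose_spec)).toMul else 1, fun α β x hα hβ => ?_⟩
    beta_reduce
    rw [dif_pos ⟨x, hα⟩, dif_pos ⟨x, hβ⟩]
    have h := congrFun hσ (Cech.Simplex.edge α β hα hβ)
    rw [Cech.coboundary_zero_apply, Cech.Simplex.face_zero_edge, Cech.Simplex.face_one_edge] at h
    have h' : _ = Additive.ofMul (orthogonalDet (T.transition α β x hα hβ)) :=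
      h.trans (T.detCochain_apply hT (Cech.Simplex.edge α β hα hβ) x hα hβ)
    rw [orthogonalDet_transition] at h'
    have h'' := congrArg Additive.toMul h'
    rw [toMul_sub, div_eq_mul_inv, Int.units_inv_eq_self, mul_comm] at h''
    exact h''.symm
  · rintro ⟨τ, hτ⟩
    refine ⟨fun a => Additive.ofMul (τ (a.1 0)), funext fun a => ?_⟩
    obtain ⟨x, hx⟩ := a.2
    have h0 : x ∈ T.U (a.1 0) := Set.mem_iInter.1 hx 0
    have h1 : x ∈ T.U (a.1 1) := Set.mem_iInter.1 hx 1
    rw [Cech.coboundary_zero_apply]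
    refine Eq.trans ?_ (T.detCochain_apply hT a x h0 h1).symm
    rw [orthogonalDet_transition, hτ, ← ofMul_div, div_eq_mul_inv, Int.units_inv_eq_self, mul_comm]
    rfl

/-- Composing each frame `e_α` with a constant change of basis so that the resulting orientations
agree on overlaps orients the manifold. -/
theorem isOrientable_of_orientation_map_eq (b : A → Basis (Fin n) ℝ (EuclideanSpace ℝ (Fin n)))
    (hb : ∀ α β x (hα : x ∈ T.U α) (hβ : x ∈ T.U β),
      ((b α).map (T.frame α ⟨x, hα⟩).toLinearEquiv).orientation =
        ((b β).map (T.frame β ⟨x, hβ⟩).toLinearEquiv).orientation) :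
    IsOrientable n M := by
  choose r hr using T.isCover
  refine ⟨fun x => ((b (r x)).map (T.frame (r x) ⟨x, hr x⟩).toLinearEquiv).orientation,
    fun x => ⟨T.U (r x), hr x, fun y => (b (r x)).map (T.frame (r x) y).toLinearEquiv,
      fun i => ?_, fun y => hb _ _ _ _ _⟩⟩
  simp only [Basis.map_apply]
  exact (T.smooth (r x) (b (r x) i)).continuous

theorem isOrientable_of_w₁_eq_zero (hT : Cech.IsGoodCover T.U) (h : T.w₁ hT = 0) :
    IsOrientable n M := by
  obtain ⟨τ, hτ⟩ := (T.w₁_eq_zero_iff hT).1 h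
  rcases isEmpty_or_nonempty (Fin n) with hn | hn
  · refine T.isOrientable_of_orientation_map_eq
      (fun _ => (EuclideanSpace.basisFun (Fin n) ℝ).toBasis) fun α β x hα hβ => ?_
    rw [Basis.orientation_isEmpty, Basis.orientation_isEmpty]
  · choose b hb using fun α =>
      (EuclideanSpace.basisFun (Fin n) ℝ).toBasis.exists_relSign_orientation_eq (τ α)
    refine T.isOrientable_of_orientation_map_eq b fun α β x hα hβ => ?_
    have key : ∀ γ (hγ : x ∈ T.U γ),
        relSign ((b γ).map (T.frame γ ⟨x, hγ⟩).toLinearEquiv).orientation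
          (T.frame γ ⟨x, hγ⟩).orientation = τ γ := fun γ hγ => by
      rw [OrthonormalFrame.orientation, OrthonormalFrame.basis, Basis.orientation_map,
        Basis.orientation_map, relSign_map, hb]
    have e := (T.frame α ⟨x, hα⟩).basis
    rw [← relSign_eq_one_iff, ← relSign_mul_relSign e _ (T.frame α ⟨x, hα⟩).orientation,
      ← relSign_mul_relSign e (T.frame α ⟨x, hα⟩).orientation (T.frame β ⟨x, hβ⟩).orientation,
      key α hα, hτ α β x hα hβ, relSign_comm, key β hβ, mul_assoc, Int.units_mul_self, mul_one,
      Int.units_mul_self]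

theorem w₁_eq_zero_of_isOrientable (hT : Cech.IsGoodCover T.U) (h : IsOrientable n M) :
    T.w₁ hT = 0 := by
  obtain ⟨o, ho⟩ := h
  have hlc : ∀ α, IsLocallyConstant fun y : T.U α =>
      relSign (T.frame α y).orientation (o (y : M)) := fun α => by
    refine (IsLocallyConstant.iff_exists_open _).2 fun x => ?_
    obtain ⟨V, hxV, b, hbc, hbo⟩ := ho x
    have := T.isLocallyConstant_relSign α (N := (T.U α ⊓ V : Opens M))
      (p := fun y => ⟨y, y.2.1⟩) (by fun_prop) (fun y => b ⟨y, y.2.2⟩) fun i =>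
        (hbc i).comp (Opens.isOpenEmbedding_of_le (inf_le_right : T.U α ⊓ V ≤ V)).continuous
    simp only [hbo] at this
    obtain ⟨O, hO, hxO, hconst⟩ := this.exists_open ⟨x, x.2, hxV⟩
    refine ⟨_, (Opens.isOpenEmbedding_of_le (inf_le_left : T.U α ⊓ V ≤ T.U α)).isOpenMap O hO,
      ⟨_, hxO, rfl⟩, ?_⟩
    rintro _ ⟨y, hy, rfl⟩
    exact hconst y hy
  have hconn : ∀ α, PreconnectedSpace (T.U α) := fun α => by
    rcases isEmpty_or_nonempty (T.U α) with hα | ⟨⟨x, hx⟩⟩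
    · infer_instance
    · have hset : Cech.inter T.U (k := 0) (fun _ => α) = T.U α :=
        Set.iInter_const (ι := Fin 1) _
      have := hT.contractible 0 (fun _ => α) (by rw [hset]; exact ⟨x, hx⟩)
      rw [hset] at this
      have : ContractibleSpace (T.U α) := this
      infer_instance
  have : ∀ α, ∃ s, ∀ y : T.U α, relSign (T.frame α y).orientation (o (y : M)) = s := fun α => by
    obtain ⟨s, hs⟩ := (hlc α).exists_eq_const
    exact ⟨s, fun y => congrFun hs y⟩
  choose τ hτ using this
  refine (T.w₁_eq_zero_iff hT).2 ⟨τ, fun α β x hα hβ => ?_⟩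
  rw [← hτ α ⟨x, hα⟩, ← hτ β ⟨x, hβ⟩, relSign_comm (T.frame β ⟨x, hβ⟩).orientation,
    relSign_mul_relSign (T.frame α ⟨x, hα⟩).basis]

end FrameCover

end

theorem mainTheorem7 {n : ℕ} {M : Type*} [TopologicalSpace M]
    [ChartedSpace (EuclideanSpace ℝ (Fin n)) M] [IsManifold (𝓡 n) ∞ M] [T2Space M]
    [SecondCountableTopology M] (g : RiemannianMetricOn n M) {A : Type*} (T : FrameCover g A)
    (hT : Cech.IsGoodCover T.U) :
    (∀ (g' : RiemannianMetricOn n M) {B : Type*} (T' : FrameCover g' B)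
      (hT' : Cech.IsGoodCover T'.U), Cech.Agree (T.w₁ hT) (T'.w₁ hT')) ∧
    (T.w₁ hT = 0 ↔ IsOrientable n M) :=
  ⟨fun _ _ T' hT' => T.agree_w₁ T' hT hT',
    T.isOrientable_of_w₁_eq_zero hT, T.w₁_eq_zero_of_isOrientable hT⟩
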